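/- Let $A$ be an Artin algebra, that is, an algebra that is finitely generated as a module over a commutative artinian ring $R$, and let $\Lambda = T_2(A) = \left(\begin{smallmatrix}A&A\\0&A\end{smallmatrix}\right)$ be the ring of upper triangular $2\times 2$ matrices over $A$. For $S \in \{A, \Lambda\}$, consider finitely generated left $S$-modules. For such a module $M$ let $M^* = \operatorname{Hom}_S(M,S)$, a right $S$-module, let $M^{**} = \operatorname{Hom}_S(M^*, S_S)$, a left $S$-module, and let $\phi_M : M \to M^{**}$, $\phi_M(m)(f) = f(m)$, be the canonical map. The module $M$ is *torsionless* if it embeds in a finitely generated projective left $S$-module (equivalently, if $\phi_M$ is injective), and *reflexive* if $\phi_M$ is an isomorphism. A left or right $S$-module $N$ is *semi-Gorenstein-projective* if $\operatorname{Ext}_S^i(N,S)=0$ for all $i\ge 1$; $M$ is *double semi-Gorenstein-projective* if both the left module $M$ and the right module $M^*$ are semi-Gorenstein-projective; and $M$ is *Gorenstein-projective* if it is double semi-Gorenstein-projective and reflexive. Then: 1. Every torsionless double semi-Gorenstein-projective $A$-module is Gorenstein-projective if and only if every torsionless double semi-Gorenstein-projective $T_2(A)$-module is Gorenstein-projective.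 2. Every double semi-Gorenstein-projective $A$-module $L$ with $\phi_L$ an epimorphism is Gorenstein-projective if and only if every double semi-Gorenstein-projective $T_2(A)$-module $M$ with $\phi_M$ an epimorphism is Gorenstein-projective. -/

import Mathlib

universe u v

open CategoryTheory

/-- The ring `T₂(A)` of upper triangular `2 × 2` matrices over a ring `A`, as a subring of the full
matrix ring. -/
def upperTriangularTwo (A : Type u) [Ring A] : Subring (Matrix (Fin 2) (Fin 2) A) where
  carrier := {m | m 1 0 = 0}
  mul_mem' := by
    intro a b ha hb
    simp only [Set.mem_ofPred_eq] at ha hb ⊢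
    simp [Matrix.mul_apply, Fin.sum_univ_two, ha, hb]
  one_mem' := by simp
  add_mem' := by
    intro a b ha hb
    simp only [Set.mem_ofPred_eq] at ha hb ⊢
    simp [ha, hb]
  zero_mem' := by simp
  neg_mem' := by
    intro a ha
    simp only [Set.mem_ofPred_eq] at ha ⊢
    simp [ha]

/-- The dual `M^* = Hom_A(M, A)` of a left `A`-module. It is a right `A`-module (that is, a module
over `Aᵐᵒᵖ`) through `(f a)(m) = f(m) a`. -/
abbrev LeftDual (A : Type u) [Ring A] (M : Type u) [AddCommGroup M] [Module A M] : Type u :=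
  M →ₗ[A] A

/-- The dual `N^* = Hom_A(N, A_A)` of a right `A`-module. It is a left `A`-module through
`(a f)(n) = a f(n)`. -/
abbrev RightDual (A : Type u) [Ring A] (N : Type u) [AddCommGroup N] [Module Aᵐᵒᵖ N] : Type u :=
  N →ₗ[Aᵐᵒᵖ] A

/-- The canonical map `φ_M : M → M^{**}` of left `A`-modules, `φ_M(m)(f) = f(m)`. -/
def canonicalMap (A : Type u) [Ring A] (M : Type u) [AddCommGroup M] [Module A M] :
    M →ₗ[A] RightDual A (LeftDual A M) where
  toFun m :=
    { toFun := fun f => f m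
      map_add' := fun _ _ => rfl
      map_smul' := fun _ _ => rfl }
  map_add' m m' := by
    ext f
    exact map_add f m m'
  map_smul' a m := by
    ext f
    exact map_smul f a m

/-- A left `A`-module `M` is semi-Gorenstein-projective if `Ext_A^i(M, A) = 0` for all `i ≥ 1`. -/
def IsSemiGorensteinProjective (A : Type u) [Ring A] (M : Type u) [AddCommGroup M]
    [Module A M] : Prop :=
  ∀ i : ℕ, 1 ≤ i →
    Subsingleton (Abelian.Ext.{u} (ModuleCat.of.{u} A M) (ModuleCat.of.{u} A A) i)

/-- A right `A`-module `N` is semi-Gorenstein-projective if `Ext^i(N, A_A) = 0` for all `i ≥ 1`,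
the extension groups being those of right `A`-modules. -/
def IsRightSemiGorensteinProjective (A : Type u) [Ring A] (N : Type u) [AddCommGroup N]
    [Module Aᵐᵒᵖ N] : Prop :=
  ∀ i : ℕ, 1 ≤ i →
    Subsingleton (Abelian.Ext.{u} (ModuleCat.of.{u} Aᵐᵒᵖ N) (ModuleCat.of.{u} Aᵐᵒᵖ A) i)

/-- A left `A`-module `M` is double semi-Gorenstein-projective if both the left module `M` and the
right module `M^*` are semi-Gorenstein-projective. -/
def IsDoubleSemiGorensteinProjective (A : Type u) [Ring A] (M : Type u) [AddCommGroup M]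
    [Module A M] : Prop :=
  IsSemiGorensteinProjective A M ∧ IsRightSemiGorensteinProjective A (LeftDual A M)

/-- A left `A`-module is torsionless if it is isomorphic to a submodule of a (finitely generated)
projective left `A`-module. -/
def IsTorsionless (A : Type u) [Ring A] (M : Type u) [AddCommGroup M] [Module A M] : Prop :=
  ∃ (P : Type u) (_ : AddCommGroup P) (_ : Module A P),
    Module.Finite A P ∧ Module.Projective A P ∧ ∃ f : M →ₗ[A] P, Function.Injective f

/-- A left `A`-module `M` is reflexive if `φ_M : M → M^{**}` is an isomorphism. -/
def IsReflexiveModule (A : Type u) [Ring A] (M : Type u) [AddCommGroup M] [Module A M] : Prop :=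
  Function.Bijective (canonicalMap A M)

/-- A (finitely generated) left `A`-module is Gorenstein-projective (Auslander and Bridger: of
`G`-dimension zero) if it is double semi-Gorenstein-projective and reflexive. -/
def IsGorensteinProjective (A : Type u) [Ring A] (M : Type u) [AddCommGroup M]
    [Module A M] : Prop :=
  IsDoubleSemiGorensteinProjective A M ∧ IsReflexiveModule A M

/-! With `p`, `q` the diagonal idempotents of `Λ` and `n` the off-diagonal unit, a `Λ`-module `M` is
an `A`-linear map `n : qM → pM`, and `M = pM ⊕ qM` over `A`. Everything rests on the condition
`DualSurjective`: every form on `qM` is the pullback along `n` of a form on `pM`. Under it, each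
property in question holds for `M` over `Λ` exactly when it holds for `M` over `A`.

Dimension shifting along a free `Λ`-presentation shows that `M` is semi-Gorenstein-projective over
`Λ` iff it is so over `A` and `DualSurjective` holds
(`TriangularCoordinates.isSemiGorensteinProjective_iff`).

For the dual, `Hom_Λ(M, Λ) = (coker n)^* × (pM)^*`, with right multiplication by `n` the inclusion
of the first factor in the second. Since `Λᵐᵒᵖ` is again triangular, the same criterion applies to
this module. `DualSurjective` makes `0 → (coker n)^* → (pM)^* → (qM)^* → 0` exact, and its long
exact sequence identifies the criterion with the vanishing of Ext for `(pM)^* ⊕ (qM)^* = Hom_A(M,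
A)` (`isDoubleSemiGorensteinProjective_iff`). The same sequence compares the two canonical maps
(`canonicalMap_injective_iff`, `canonicalMap_surjective_iff`).

Hence a `Λ`-module is handled by restriction to `A`, and an `A`-module `L` by the `Λ`-module `0 →
L`, for which `DualSurjective` is trivial. -/

/-- `Ext_S^i(M, C) = 0` for `1 ≤ i ≤ k`. -/
def ExtVanishesUpTo (S : Type u) [Ring S] (M C : Type u) [AddCommGroup M] [Module S M]
    [AddCommGroup C] [Module S C] (k : ℕ) : Prop :=
  ∀ i : ℕ, 1 ≤ i → i ≤ k →
    Subsingleton (Abelian.Ext.{u} (ModuleCat.of.{u} S M) (ModuleCat.of.{u} S C) i)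

/-! ### Dimension shifting for Ext -/

section Ext

variable {S : Type u} [Ring S] {K P M C : Type u}
  [AddCommGroup K] [Module S K] [AddCommGroup P] [Module S P]
  [AddCommGroup M] [Module S M] [AddCommGroup C] [Module S C]

theorem isSemiGorensteinProjective_iff_extVanishesUpTo :
    IsSemiGorensteinProjective S M ↔ ∀ k, ExtVanishesUpTo S M S k :=
  ⟨fun h _ i hi _ => h i hi, fun h i hi => h i i hi le_rfl⟩

theorem extVanishesUpTo_of_projective [Module.Projective S P] (k : ℕ) :
    ExtVanishesUpTo S P C k := by
  intro i hi _
  have : Projective (ModuleCat.of.{u} S P) :=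
    (IsProjective.iff_projective (ModuleCat.of.{u} S P)).1 inferInstance
  obtain ⟨j, rfl⟩ : ∃ j, i = j + 1 := ⟨i - 1, by omega⟩
  exact Abelian.Ext.subsingleton_of_projective _ _ _

theorem subsingleton_ext_of_equiv {M' C' : Type u} [AddCommGroup M'] [Module S M']
    [AddCommGroup C'] [Module S C'] (e : M ≃ₗ[S] M') (e' : C ≃ₗ[S] C') (i : ℕ)
    (h : Subsingleton (Abelian.Ext.{u} (ModuleCat.of.{u} S M) (ModuleCat.of.{u} S C) i)) :
    Subsingleton (Abelian.Ext.{u} (ModuleCat.of.{u} S M') (ModuleCat.of.{u} S C') i) := by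
  have key : ∀ x : Abelian.Ext.{u} (ModuleCat.of.{u} S M') (ModuleCat.of.{u} S C') i, x = 0 := by
    intro x
    have h1 : (Abelian.Ext.mk₀ (e.symm.toModuleIso.hom)).comp
        (((Abelian.Ext.mk₀ (e.toModuleIso.hom)).comp
          (x.comp (Abelian.Ext.mk₀ (e'.symm.toModuleIso.hom)) (add_zero i)) (zero_add i)).comp
        (Abelian.Ext.mk₀ (e'.toModuleIso.hom)) (add_zero i)) (zero_add i) = x := by
      have a : e.symm.toModuleIso.hom ≫ e.toModuleIso.hom = 𝟙 _ := by ext; simp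
      have b : e'.symm.toModuleIso.hom ≫ e'.toModuleIso.hom = 𝟙 _ := by ext; simp
      simp only [Abelian.Ext.comp_assoc_of_third_deg_zero, Abelian.Ext.mk₀_comp_mk₀_assoc,
        Abelian.Ext.mk₀_comp_mk₀, a, b, Abelian.Ext.mk₀_id_comp, Abelian.Ext.comp_mk₀_id]
    rw [← h1, Subsingleton.elim ((Abelian.Ext.mk₀ (e.toModuleIso.hom)).comp
          (x.comp (Abelian.Ext.mk₀ (e'.symm.toModuleIso.hom)) (add_zero i)) (zero_add i)) 0]
    simp
  exact subsingleton_of_forall_eq 0 key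

theorem IsSemiGorensteinProjective.of_equiv {M' : Type u} [AddCommGroup M'] [Module S M']
    (e : M ≃ₗ[S] M') (h : IsSemiGorensteinProjective S M) : IsSemiGorensteinProjective S M' :=
  fun i hi => subsingleton_ext_of_equiv e (LinearEquiv.refl S S) i (h i hi)

/-- A ring is isomorphic, as a right module over itself, to its opposite ring. -/
def opSelfLinearEquiv (A : Type u) [Ring A] : A ≃ₗ[Aᵐᵒᵖ] Aᵐᵒᵖ where
  toFun := MulOpposite.op
  invFun := MulOpposite.unop
  map_add' _ _ := rfl
  map_smul' _ _ := rfl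
  left_inv _ := rfl
  right_inv _ := rfl

theorem isRightSemiGorensteinProjective_iff {A N : Type u} [Ring A] [AddCommGroup N]
    [Module Aᵐᵒᵖ N] :
    IsRightSemiGorensteinProjective A N ↔ IsSemiGorensteinProjective Aᵐᵒᵖ N :=
  ⟨fun h i hi => subsingleton_ext_of_equiv (LinearEquiv.refl _ _) (opSelfLinearEquiv A) i (h i hi),
   fun h i hi =>
    subsingleton_ext_of_equiv (LinearEquiv.refl _ _) (opSelfLinearEquiv A).symm i (h i hi)⟩

/-- A short exact sequence of modules, as a short complex in the category of modules. -/
abbrev moduleShortComplex (f : K →ₗ[S] P) (g : P →ₗ[S] M) (h : Function.Exact f g) :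
    ShortComplex (ModuleCat.{u} S) :=
  ShortComplex.mk (ModuleCat.ofHom f) (ModuleCat.ofHom g) (by
    ext x; exact h.apply_apply_eq_zero x)

theorem moduleShortComplex_shortExact {f : K →ₗ[S] P} {g : P →ₗ[S] M} (hf : Function.Injective f)
    (h : Function.Exact f g) (hg : Function.Surjective g) :
    (moduleShortComplex f g h).ShortExact :=
  ModuleCat.shortComplex_shortExact _ h hf hg

/-- In the long exact sequence, degree 1 for `M` is controlled by restriction of maps from `P` to
`K`, and degree `i + 1` by degree `i` for `K`. The bound `k` is kept explicit for the later
inductions, one of which loses a degree. -/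
theorem extVanishesUpTo_succ_iff {f : K →ₗ[S] P} {g : P →ₗ[S] M} (hf : Function.Injective f)
    (h : Function.Exact f g) (hg : Function.Surjective g) (k : ℕ)
    (hP : ExtVanishesUpTo S P C (k + 1)) :
    ExtVanishesUpTo S M C (k + 1) ↔
      ExtVanishesUpTo S K C k ∧ ∀ u : K →ₗ[S] C, ∃ w : P →ₗ[S] C, w ∘ₗ f = u := by
  have hS := moduleShortComplex_shortExact hf h hg
  constructor
  · intro hM
    refine ⟨fun i hi hik => ?_, fun u => ?_⟩
    · have key : ∀ x : Abelian.Ext.{u} (ModuleCat.of.{u} S K) (ModuleCat.of.{u} S C) i,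
          x = 0 := by
        intro x
        have := hM (i + 1) (by omega) (by omega)
        have := hP i hi (by omega)
        obtain ⟨y, hy⟩ := Abelian.Ext.contravariant_sequence_exact₁ hS (ModuleCat.of.{u} S C) x
          (n₁ := i + 1) (by omega)
          (Subsingleton.elim (α := Abelian.Ext.{u} (ModuleCat.of.{u} S M)
            (ModuleCat.of.{u} S C) (i + 1)) _ _)
        rw [← hy, Subsingleton.elim (α := Abelian.Ext.{u} (ModuleCat.of.{u} S P)
            (ModuleCat.of.{u} S C) i) y 0, Abelian.Ext.comp_zero]
      exact subsingleton_of_forall_eq 0 key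
    · have := hM 1 le_rfl (by omega)
      obtain ⟨y, hy⟩ := Abelian.Ext.contravariant_sequence_exact₁ hS (ModuleCat.of.{u} S C)
          (Abelian.Ext.mk₀ (ModuleCat.ofHom u)) (n₁ := 1) rfl
          (Subsingleton.elim (α := Abelian.Ext.{u} (ModuleCat.of.{u} S M)
            (ModuleCat.of.{u} S C) 1) _ _)
      obtain ⟨w, rfl⟩ := (Abelian.Ext.mk₀_bijective _ _).2 y
      rw [Abelian.Ext.mk₀_comp_mk₀] at hy
      have := (Abelian.Ext.mk₀_bijective _ _).1 hy
      exact ⟨w.hom, congrArg ModuleCat.Hom.hom this⟩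
  · rintro ⟨hK, hext⟩ i hi hik
    have key : ∀ x : Abelian.Ext.{u} (ModuleCat.of.{u} S M) (ModuleCat.of.{u} S C) i,
        x = 0 := by
      intro x
      have := hP i hi hik
      obtain ⟨j, rfl⟩ : ∃ j, i = 1 + j := ⟨i - 1, by omega⟩
      obtain ⟨y, hy⟩ := Abelian.Ext.contravariant_sequence_exact₃ hS (ModuleCat.of.{u} S C) x
        (Subsingleton.elim (α := Abelian.Ext.{u} (ModuleCat.of.{u} S P)
            (ModuleCat.of.{u} S C) (1 + j)) _ _) (n₀ := j) rfl
      -- In degree 1 the class comes from a map `K → C`; such a map extends to `P`, and `f` composed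
      -- with the connecting class is zero.
      rcases Nat.eq_zero_or_pos j with rfl | hj
      · obtain ⟨v, rfl⟩ := (Abelian.Ext.mk₀_bijective _ _).2 y
        obtain ⟨w, hw⟩ := hext v.hom
        have hv : v = (moduleShortComplex f g h).f ≫ ModuleCat.ofHom w := by
          ext x
          exact (LinearMap.congr_fun hw x).symm
        rw [← hy, hv, ← Abelian.Ext.mk₀_comp_mk₀]
        exact hS.extClass_comp_assoc _
      · have := hK j hj (by omega)
        rw [← hy, Subsingleton.elim (α := Abelian.Ext.{u} (ModuleCat.of.{u} S K)
            (ModuleCat.of.{u} S C) j) y 0, Abelian.Ext.comp_zero]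
    exact subsingleton_of_forall_eq 0 key

theorem isSemiGorensteinProjective_iff_of_shortExact {f : K →ₗ[S] P} {g : P →ₗ[S] M}
    (hf : Function.Injective f) (h : Function.Exact f g) (hg : Function.Surjective g)
    (hP : IsSemiGorensteinProjective S P) :
    IsSemiGorensteinProjective S M ↔
      IsSemiGorensteinProjective S K ∧ ∀ u : K →ₗ[S] S, ∃ w : P →ₗ[S] S, w ∘ₗ f = u := by
  simp only [isSemiGorensteinProjective_iff_extVanishesUpTo] at hP ⊢
  constructor
  · intro hM
    exact ⟨fun k => ((extVanishesUpTo_succ_iff hf h hg k (hP _)).1 (hM _)).1,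
      ((extVanishesUpTo_succ_iff hf h hg 0 (hP _)).1 (hM _)).2⟩
  · rintro ⟨hK, hext⟩ k
    cases k with
    | zero => intro i hi hi'; omega
    | succ k => exact (extVanishesUpTo_succ_iff hf h hg k (hP _)).2 ⟨hK k, hext⟩

theorem isSemiGorensteinProjective_prod_iff :
    IsSemiGorensteinProjective S (K × M) ↔
      IsSemiGorensteinProjective S K ∧ IsSemiGorensteinProjective S M := by
  constructor
  · intro h
    have aux : ∀ {X : Type u} [AddCommGroup X] [Module S X] (a : X →ₗ[S] K × M)
        (b : K × M →ₗ[S] X), b ∘ₗ a = LinearMap.id → IsSemiGorensteinProjective S X := by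
      intro X _ _ a b hab i hi
      have key : ∀ x : Abelian.Ext.{u} (ModuleCat.of.{u} S X) (ModuleCat.of.{u} S S) i,
          x = 0 := by
        intro x
        have := h i hi
        have hab' : ModuleCat.ofHom a ≫ ModuleCat.ofHom b = 𝟙 _ := by
          rw [← ModuleCat.ofHom_comp, hab]; rfl
        rw [← Abelian.Ext.mk₀_id_comp x, ← hab', ← Abelian.Ext.mk₀_comp_mk₀_assoc,
          Subsingleton.elim ((Abelian.Ext.mk₀ (ModuleCat.ofHom b)).comp x (zero_add i)) 0,
          Abelian.Ext.comp_zero]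
      exact subsingleton_of_forall_eq 0 key
    exact ⟨aux (LinearMap.inl S K M) (LinearMap.fst S K M) (by ext; rfl),
      aux (LinearMap.inr S K M) (LinearMap.snd S K M) (by ext; rfl)⟩
  · rintro ⟨hK, hM⟩ i hi
    have hS := moduleShortComplex_shortExact (S := S) (f := LinearMap.inl S K M)
      (g := LinearMap.snd S K M) LinearMap.inl_injective Function.Exact.inl_snd
      LinearMap.snd_surjective
    have key : ∀ x : Abelian.Ext.{u} (ModuleCat.of.{u} S (K × M)) (ModuleCat.of.{u} S S) i,
        x = 0 := by
      intro x
      have := hK i hi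
      have := hM i hi
      obtain ⟨y, hy⟩ := Abelian.Ext.contravariant_sequence_exact₂ hS (ModuleCat.of.{u} S S) x
        (Subsingleton.elim (α := Abelian.Ext.{u} (ModuleCat.of.{u} S K)
            (ModuleCat.of.{u} S S) i) _ _)
      rw [← hy, Subsingleton.elim (α := Abelian.Ext.{u} (ModuleCat.of.{u} S M)
            (ModuleCat.of.{u} S S) i) y 0, Abelian.Ext.comp_zero]
    exact subsingleton_of_forall_eq 0 key

end Ext

theorem LinearMap.exists_comp_eq_of_surjective {S : Type*} [Ring S] {P M C : Type*}
    [AddCommGroup P] [Module S P] [AddCommGroup M] [Module S M] [AddCommGroup C] [Module S C]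
    {g : P →ₗ[S] M} (hg : Function.Surjective g) (t : P →ₗ[S] C) (ht : ∀ x, g x = 0 → t x = 0) :
    ∃ s : M →ₗ[S] C, ∀ x, s (g x) = t x := by
  refine ⟨(LinearMap.ker g).liftQ t (fun x hx => ht x hx) ∘ₗ
    (g.quotKerEquivOfSurjective hg).symm.toLinearMap, fun x => ?_⟩
  have : (g.quotKerEquivOfSurjective hg).symm (g x) = (LinearMap.ker g).mkQ x := by
    rw [LinearEquiv.symm_apply_eq]; rfl
  simp only [LinearMap.comp_apply, LinearEquiv.coe_coe, this]
  exact Submodule.liftQ_apply _ _ _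

/-! ### Triangular rings in coordinates, usable for both `Λ` and its opposite -/

/-- Coordinates identifying a ring `Γ` with the ring of upper triangular `2 × 2` matrices over
`B`: the element with coordinates `(a, b, c)` corresponds to the matrix with first row `(a, b)` and
second row `(0, c)`. -/
structure TriangularCoordinates (B Γ : Type u) [Ring B] [Ring Γ] [Module B Γ] where
  /-- The entries of an element of `Γ`. -/
  coord : Γ ≃ₗ[B] B × B × B
  coord_one : coord 1 = (1, 0, 1)
  coord_mul : ∀ x y, coord (x * y) = ((coord x).1 * (coord y).1,
    (coord x).1 * (coord y).2.1 + (coord x).2.1 * (coord y).2.2, (coord x).2.2 * (coord y).2.2)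

set_option linter.unusedSectionVars false

namespace TriangularCoordinates

section

variable {B Γ : Type u} [Ring B] [Ring Γ] [Module B Γ] (c : TriangularCoordinates B Γ)

/-- The first diagonal idempotent. -/
def p : Γ := c.coord.symm (1, 0, 0)

/-- The off-diagonal matrix unit. -/
def n : Γ := c.coord.symm (0, 1, 0)

/-- The second diagonal idempotent. -/
def q : Γ := c.coord.symm (0, 0, 1)

@[simp] theorem coord_p : c.coord c.p = (1, 0, 0) := by simp [p]
@[simp] theorem coord_n : c.coord c.n = (0, 1, 0) := by simp [n]
@[simp] theorem coord_q : c.coord c.q = (0, 0, 1) := by simp [q]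

theorem p_mul_p : c.p * c.p = c.p := c.coord.injective (by simp [coord_mul])
theorem p_mul_n : c.p * c.n = c.n := c.coord.injective (by simp [coord_mul])
theorem p_mul_q : c.p * c.q = 0 := c.coord.injective (by simp [coord_mul])
theorem n_mul_p : c.n * c.p = 0 := c.coord.injective (by simp [coord_mul])
theorem n_mul_q : c.n * c.q = c.n := c.coord.injective (by simp [coord_mul])
theorem q_mul_q : c.q * c.q = c.q := c.coord.injective (by simp [coord_mul])
theorem q_mul_p : c.q * c.p = 0 := c.coord.injective (by simp [coord_mul])
theorem q_mul_n : c.q * c.n = 0 := c.coord.injective (by simp [coord_mul])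
theorem p_add_q : c.p + c.q = 1 := c.coord.injective (by simp [coord_one])

theorem n_mul (x : Γ) : c.n * x = (c.coord x).2.2 • c.n :=
  c.coord.injective (by simp [coord_mul])

theorem eq_sum (x : Γ) :
    x = (c.coord x).1 • c.p + (c.coord x).2.1 • c.n + (c.coord x).2.2 • c.q :=
  c.coord.injective (by simp)

theorem projective (c : TriangularCoordinates B Γ) : Module.Projective B Γ :=
  Module.Projective.of_equiv c.coord.symm

/-- The `B`-linear endomorphism of `Γ` moving the off-diagonal entry to the second diagonal
position. -/
def shift : Γ →ₗ[B] Γ :=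
  c.coord.symm.toLinearMap ∘ₗ LinearMap.inr B B (B × B) ∘ₗ LinearMap.inr B B B ∘ₗ
    LinearMap.fst B B B ∘ₗ LinearMap.snd B B (B × B) ∘ₗ c.coord.toLinearMap

theorem shift_n_mul (x : Γ) : c.shift (c.n * x) = c.q * x :=
  c.coord.injective (by simp [shift, coord_mul])

end

section

variable {B Γ K : Type u} [Ring B] [Ring Γ] [Module B Γ] (c : TriangularCoordinates B Γ)
  [AddCommGroup K] [Module Γ K]

@[simp] theorem p_smul_p (k : K) : c.p • c.p • k = c.p • k := by rw [smul_smul, p_mul_p]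
@[simp] theorem p_smul_n (k : K) : c.p • c.n • k = c.n • k := by rw [smul_smul, p_mul_n]
@[simp] theorem p_smul_q (k : K) : c.p • c.q • k = 0 := by rw [smul_smul, p_mul_q, zero_smul]
@[simp] theorem n_smul_p (k : K) : c.n • c.p • k = 0 := by rw [smul_smul, n_mul_p, zero_smul]
@[simp] theorem n_smul_q (k : K) : c.n • c.q • k = c.n • k := by rw [smul_smul, n_mul_q]
@[simp] theorem q_smul_q (k : K) : c.q • c.q • k = c.q • k := by rw [smul_smul, q_mul_q]
@[simp] theorem q_smul_p (k : K) : c.q • c.p • k = 0 := by rw [smul_smul, q_mul_p, zero_smul]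
@[simp] theorem q_smul_n (k : K) : c.q • c.n • k = 0 := by rw [smul_smul, q_mul_n, zero_smul]

theorem p_smul_add_q_smul (k : K) : c.p • k + c.q • k = k := by
  rw [← add_smul, p_add_q, one_smul]

variable [Module B K] [IsScalarTower B Γ K]

theorem smul_eq_sum (x : Γ) (k : K) : x • k =
    (c.coord x).1 • c.p • k + (c.coord x).2.1 • c.n • k + (c.coord x).2.2 • c.q • k := by
  conv_lhs => rw [c.eq_sum x]
  simp only [add_smul, smul_assoc]

theorem n_smul_smul (x : Γ) (k : K) : c.n • x • k = (c.coord x).2.2 • c.n • k := by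
  rw [smul_smul, n_mul, smul_assoc]

theorem mul_smul_one_eq {x : Γ} (hx : ∀ b : B, x * (b • 1 : Γ) = b • x) (b : B) (k : K) :
    x • b • k = b • x • k := by
  have h : b • k = (b • 1 : Γ) • k := by rw [smul_assoc, one_smul]
  rw [h, smul_smul, hx, smul_assoc]

end

variable {B Γ : Type u} [Ring B] [Ring Γ] [Module B Γ] [IsScalarTower B Γ Γ]
  (c : TriangularCoordinates B Γ)

/-! ### Modules over a triangular ring and their forms -/

section Module

variable {K : Type u} [AddCommGroup K] [Module B K] [Module Γ K] [IsScalarTower B Γ K]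

/-- Multiplication by an element of `Γ` that commutes with the scalars of `B`. -/
def smulMap (x : Γ) (hx : ∀ b : B, x * (b • 1 : Γ) = b • x) (K : Type u) [AddCommGroup K]
    [Module B K] [Module Γ K] [IsScalarTower B Γ K] : K →ₗ[B] K where
  toFun k := x • k
  map_add' := smul_add x
  map_smul' b k := mul_smul_one_eq hx b k

variable (K) in
/-- Multiplication by `p`. -/
def pMap : K →ₗ[B] K := smulMap c.p
  (fun b => c.coord.injective (by simp [coord_mul, coord_one])) K

variable (K) in
/-- Multiplication by `n`. -/
def nMap : K →ₗ[B] K := smulMap c.n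
  (fun b => c.coord.injective (by simp [coord_mul, coord_one])) K

variable (K) in
/-- Multiplication by `q`. -/
def qMap : K →ₗ[B] K := smulMap c.q
  (fun b => c.coord.injective (by simp [coord_mul, coord_one])) K

@[simp] theorem pMap_apply (k : K) : c.pMap K k = c.p • k := rfl
@[simp] theorem nMap_apply (k : K) : c.nMap K k = c.n • k := rfl
@[simp] theorem qMap_apply (k : K) : c.qMap K k = c.q • k := rfl

theorem map_p_smul {w : K →ₗ[B] B} (hw : ∀ k, w (c.q • k) = 0) (k : K) : w (c.p • k) = w k := by
  conv_rhs => rw [← c.p_smul_add_q_smul k, map_add, hw, add_zero]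

/-- The `Γ`-linear map `K → Γ` whose value at `k` has coordinates `(u k, v k, v (n k))`. -/
def homOfPair (u v : K →ₗ[B] B) (hu : ∀ k, u (c.q • k) = 0) (hn : ∀ k, u (c.n • k) = 0)
    (hv : ∀ k, v (c.q • k) = 0) : K →ₗ[Γ] Γ where
  toFun k := c.coord.symm (u k, v k, v (c.n • k))
  map_add' k l := c.coord.injective (by simp)
  map_smul' x k := by
    apply c.coord.injective
    have h1 : u (x • k) = (c.coord x).1 * u k := by
      rw [c.smul_eq_sum x k]; simp [hu, hn, c.map_p_smul hu]
    have h2 : v (x • k) = (c.coord x).1 * v k + (c.coord x).2.1 * v (c.n • k) := by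
      rw [c.smul_eq_sum x k]; simp [hv, c.map_p_smul hv]
    have h3 : v (c.n • x • k) = (c.coord x).2.2 * v (c.n • k) := by
      rw [c.n_smul_smul]; simp
    simp [coord_mul, h1, h2, h3]

theorem coord_homOfPair (u v : K →ₗ[B] B) (hu : ∀ k, u (c.q • k) = 0)
    (hn : ∀ k, u (c.n • k) = 0) (hv : ∀ k, v (c.q • k) = 0) (k : K) :
    c.coord (c.homOfPair u v hu hn hv k) = (u k, v k, v (c.n • k)) := by
  simp [homOfPair]

/-- The first diagonal entry of a `Γ`-linear map `K → Γ`. -/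
def diagEntry (φ : K →ₗ[Γ] Γ) : K →ₗ[B] B :=
  LinearMap.fst B B (B × B) ∘ₗ c.coord.toLinearMap ∘ₗ φ.restrictScalars B

/-- The off-diagonal entry of a `Γ`-linear map `K → Γ`. -/
def offDiagEntry (φ : K →ₗ[Γ] Γ) : K →ₗ[B] B :=
  LinearMap.fst B B B ∘ₗ LinearMap.snd B B (B × B) ∘ₗ c.coord.toLinearMap ∘ₗ φ.restrictScalars B

/-- Left multiplication by `n` moves the second diagonal entry to the off-diagonal place, so
linearity forces the last coordinate. Together with `homOfPair` this gives `Hom_Γ(K, Γ) = (coker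
n)^* × (pK)^*`. -/
theorem coord_apply (φ : K →ₗ[Γ] Γ) (k : K) :
    c.coord (φ k) = (c.diagEntry φ k, c.offDiagEntry φ k, c.offDiagEntry φ (c.n • k)) := by
  simp [diagEntry, offDiagEntry, coord_mul]

theorem diagEntry_q (φ : K →ₗ[Γ] Γ) (k : K) : c.diagEntry φ (c.q • k) = 0 := by
  simp [diagEntry, coord_mul]

theorem diagEntry_n (φ : K →ₗ[Γ] Γ) (k : K) : c.diagEntry φ (c.n • k) = 0 := by
  simp [diagEntry, coord_mul]

theorem offDiagEntry_q (φ : K →ₗ[Γ] Γ) (k : K) : c.offDiagEntry φ (c.q • k) = 0 := by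
  simp [offDiagEntry, coord_mul]

theorem diagEntry_homOfPair (u v : K →ₗ[B] B) (hu : ∀ k, u (c.q • k) = 0)
    (hn : ∀ k, u (c.n • k) = 0) (hv : ∀ k, v (c.q • k) = 0) :
    c.diagEntry (c.homOfPair u v hu hn hv) = u := by
  ext k; simp [diagEntry, coord_homOfPair]

theorem offDiagEntry_homOfPair (u v : K →ₗ[B] B) (hu : ∀ k, u (c.q • k) = 0)
    (hn : ∀ k, u (c.n • k) = 0) (hv : ∀ k, v (c.q • k) = 0) :
    c.offDiagEntry (c.homOfPair u v hu hn hv) = v := by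
  ext k; simp [offDiagEntry, coord_homOfPair]

theorem hom_ext {φ ψ : K →ₗ[Γ] Γ} (h₁ : c.diagEntry φ = c.diagEntry ψ)
    (h₂ : c.offDiagEntry φ = c.offDiagEntry ψ) : φ = ψ := by
  ext k
  apply c.coord.injective
  rw [coord_apply, coord_apply, h₁, h₂]

variable (K) in
/-- If `K` is regarded as a `B`-linear map `n : q K → p K`, this says that the dual map
`(p K)^* → (q K)^*` is surjective. -/
def DualSurjective : Prop :=
  ∀ h : K →ₗ[B] B, ∃ v : K →ₗ[B] B, ∀ k, v (c.n • k) = h (c.q • k)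

theorem DualSurjective.exists_of_q {c : TriangularCoordinates B Γ} (H : c.DualSurjective K)
    (h : K →ₗ[B] B) :
    ∃ v : K →ₗ[B] B, (∀ k, v (c.q • k) = 0) ∧ ∀ k, v (c.n • k) = h (c.q • k) := by
  obtain ⟨v, hv⟩ := H h
  exact ⟨v ∘ₗ c.pMap K, fun k => by simp, fun k => by simp [hv]⟩

/-- In `Γ`, `n * x` and `q * x` carry the same single entry in different positions; `shift` takes
the first to the second. -/
theorem dualSurjective_finsupp (ι : Type u) : c.DualSurjective (ι →₀ Γ) := by
  intro h
  refine ⟨h ∘ₗ Finsupp.mapRange.linearMap c.shift, fun k => ?_⟩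
  rw [LinearMap.comp_apply]
  congr 1
  ext i
  simp [shift_n_mul]

end Module

/-! ### Extension of forms along a short exact sequence -/

section ShortExact

variable {K P M : Type u}
  [AddCommGroup K] [Module B K] [Module Γ K] [IsScalarTower B Γ K]
  [AddCommGroup P] [Module B P] [Module Γ P] [IsScalarTower B Γ P]
  [AddCommGroup M] [Module B M] [Module Γ M] [IsScalarTower B Γ M]
  {f : K →ₗ[Γ] P} {g : P →ₗ[Γ] M}

theorem exists_extension_of_q (hext : ∀ φ : K →ₗ[Γ] Γ, ∃ ψ : P →ₗ[Γ] Γ, ψ ∘ₗ f = φ)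
    (v : K →ₗ[B] B) (hv : ∀ k, v (c.q • k) = 0) :
    ∃ w : P →ₗ[B] B, (∀ k, w (f k) = v k) ∧ ∀ x, w (c.q • x) = 0 := by
  obtain ⟨ψ, hψ⟩ := hext (c.homOfPair 0 v (by simp) (by simp) hv)
  refine ⟨c.offDiagEntry ψ, fun k => ?_, c.offDiagEntry_q ψ⟩
  have := congrArg (fun φ => c.offDiagEntry φ k) hψ
  simp only [offDiagEntry_homOfPair] at this
  exact this

theorem exists_extension_of_q_n (hext : ∀ φ : K →ₗ[Γ] Γ, ∃ ψ : P →ₗ[Γ] Γ, ψ ∘ₗ f = φ)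
    (u : K →ₗ[B] B) (hq : ∀ k, u (c.q • k) = 0) (hn : ∀ k, u (c.n • k) = 0) :
    ∃ w : P →ₗ[B] B, (∀ k, w (f k) = u k) ∧ (∀ x, w (c.q • x) = 0) ∧ ∀ x, w (c.n • x) = 0 := by
  obtain ⟨ψ, hψ⟩ := hext (c.homOfPair u 0 hq hn (by simp))
  refine ⟨c.diagEntry ψ, fun k => ?_, c.diagEntry_q ψ, c.diagEntry_n ψ⟩
  have := congrArg (fun φ => c.diagEntry φ k) hψ
  simp only [diagEntry_homOfPair] at this
  exact this

/-- Lift a form on `M` to `P` and solve the problem there by `v`. On `K` the solution kills `qK` and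
`nK`, so it is the diagonal entry of a `Γ`-map; subtracting an extension of it makes `v` descend to
`M` without changing its values on `nP`. -/
theorem dualSurjective_of_extension (h : Function.Exact f g)
    (hg : Function.Surjective g) (hP : c.DualSurjective P)
    (hext : ∀ φ : K →ₗ[Γ] Γ, ∃ ψ : P →ₗ[Γ] Γ, ψ ∘ₗ f = φ) : c.DualSurjective M := by
  intro a
  obtain ⟨v, hvq, hvn⟩ := hP.exists_of_q (a ∘ₗ g.restrictScalars B)
  obtain ⟨w, hwf, -, hwn⟩ := c.exists_extension_of_q_n hext (v ∘ₗ f.restrictScalars B)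
    (fun k => by simp [hvq]) (fun k => by simp [hvn, h.apply_apply_eq_zero])
  obtain ⟨t, ht⟩ := LinearMap.exists_comp_eq_of_surjective (g := g.restrictScalars B) hg (v - w)
    (fun x hx => by
      obtain ⟨k, rfl⟩ := (h x).1 hx
      simp [hwf])
  refine ⟨t, fun m => ?_⟩
  obtain ⟨x, rfl⟩ := hg m
  have := ht (c.n • x)
  simpa [hwn, hvn] using this

theorem extension_of_dualSurjective (hK : c.DualSurjective K)
    (hext : ∀ φ : K →ₗ[Γ] Γ, ∃ ψ : P →ₗ[Γ] Γ, ψ ∘ₗ f = φ) (a : K →ₗ[B] B) :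
    ∃ w : P →ₗ[B] B, w ∘ₗ f.restrictScalars B = a := by
  -- Split `a` along `K = pK ⊕ qK`. The `p`-part extends as an off-diagonal entry; the `q`-part is
  -- `v ∘ n`, so extending `v` suffices.
  obtain ⟨v, hvq, hvn⟩ := hK.exists_of_q a
  obtain ⟨w₁, h₁, -⟩ := c.exists_extension_of_q hext (a ∘ₗ c.pMap K) (by simp)
  obtain ⟨w₂, h₂, -⟩ := c.exists_extension_of_q hext v hvq
  refine ⟨w₁ + w₂ ∘ₗ c.nMap P, LinearMap.ext fun k => ?_⟩
  have h₃ : w₂ (c.n • f k) = a (c.q • k) := by rw [← map_smul, h₂, hvn]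
  simp only [LinearMap.comp_apply, LinearMap.add_apply, LinearMap.restrictScalars_apply,
    nMap_apply, h₃, h₁, pMap_apply]
  rw [← map_add, p_smul_add_q_smul]

theorem dualSurjective_left_of_extension (hP : c.DualSurjective P)
    (hext : ∀ a : K →ₗ[B] B, ∃ w : P →ₗ[B] B, w ∘ₗ f.restrictScalars B = a) :
    c.DualSurjective K := by
  intro a
  obtain ⟨w, rfl⟩ := hext a
  obtain ⟨v, hv⟩ := hP w
  exact ⟨v ∘ₗ f.restrictScalars B, fun k => by simp [hv]⟩

/-- Both entries of `φ` extend over `B`, but the extended diagonal entry `u` need not kill `nP`. The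
defect `u ∘ n` vanishes on `K`, hence descends to `M`, where `DualSurjective` writes it through `n`.
-/
theorem triangular_extension (h : Function.Exact f g) (hg : Function.Surjective g)
    (hM : c.DualSurjective M)
    (hext : ∀ a : K →ₗ[B] B, ∃ w : P →ₗ[B] B, w ∘ₗ f.restrictScalars B = a) (φ : K →ₗ[Γ] Γ) :
    ∃ ψ : P →ₗ[Γ] Γ, ψ ∘ₗ f = φ := by
  obtain ⟨v, hv⟩ := hext (c.offDiagEntry φ)
  obtain ⟨u, hu⟩ := hext (c.diagEntry φ)
  replace hv : ∀ k, v (f k) = c.offDiagEntry φ k := LinearMap.congr_fun hv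
  replace hu : ∀ k, u (f k) = c.diagEntry φ k := LinearMap.congr_fun hu
  have hu' : ∀ k, u (c.p • f k) = c.diagEntry φ k := fun k => by
    rw [← map_smul, hu, c.map_p_smul (c.diagEntry_q φ)]
  obtain ⟨t, ht⟩ := LinearMap.exists_comp_eq_of_surjective (g := g.restrictScalars B) hg
    (u ∘ₗ c.nMap P) (fun x hx => by
      obtain ⟨k, rfl⟩ := (h x).1 hx
      simp only [LinearMap.comp_apply, nMap_apply]
      rw [← map_smul, hu, diagEntry_n])
  obtain ⟨s, hsq, hsn⟩ := hM.exists_of_q t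
  have ht' : ∀ x, t (c.q • g x) = u (c.n • x) := fun x => by
    have := ht (c.q • x)
    simpa using this
  -- The correction `s ∘ g` cancels `u` on `nP` and is zero on the image of `K`.
  refine ⟨c.homOfPair (u ∘ₗ c.pMap P - s ∘ₗ g.restrictScalars B) (v ∘ₗ c.pMap P)
    (fun x => by simp [hsq]) (fun x => by simp [hsn, ht']) (fun x => by simp), ?_⟩
  apply c.hom_ext
  · refine LinearMap.ext fun k => ?_
    have := LinearMap.congr_fun (c.diagEntry_homOfPair (u ∘ₗ c.pMap P - s ∘ₗ g.restrictScalars B)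
      (v ∘ₗ c.pMap P) (fun x => by simp [hsq]) (fun x => by simp [hsn, ht'])
      (fun x => by simp)) (f k)
    refine Eq.trans this ?_
    simp [hu', h.apply_apply_eq_zero]
  · refine LinearMap.ext fun k => ?_
    have := LinearMap.congr_fun (c.offDiagEntry_homOfPair
      (u ∘ₗ c.pMap P - s ∘ₗ g.restrictScalars B)
      (v ∘ₗ c.pMap P) (fun x => by simp [hsq]) (fun x => by simp [hsn, ht'])
      (fun x => by simp)) (f k)
    refine Eq.trans this ?_
    simp only [LinearMap.comp_apply, pMap_apply]
    rw [← map_smul, hv, c.map_p_smul (c.offDiagEntry_q φ)]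

end ShortExact

/-! ### Comparison of Ext over `Γ` and over `B` -/

theorem projective_finsupp (c : TriangularCoordinates B Γ) (ι : Type u) : Module.Projective B (ι →₀ Γ) := by
  classical
  have := c.projective
  exact .of_equiv (finsuppLEquivDirectSum B Γ ι).symm

theorem exists_presentation (M : Type u) [AddCommGroup M] [Module B M] [Module Γ M]
    [IsScalarTower B Γ M] :
    ∃ (K P : Type u) (_ : AddCommGroup K) (_ : Module B K) (_ : Module Γ K)
      (_ : IsScalarTower B Γ K) (_ : AddCommGroup P) (_ : Module B P) (_ : Module Γ P)
      (_ : IsScalarTower B Γ P) (f : K →ₗ[Γ] P) (g : P →ₗ[Γ] M),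
      Function.Injective f ∧ Function.Exact f g ∧ Function.Surjective g ∧
        Module.Projective Γ P ∧ Module.Projective B P ∧ c.DualSurjective P :=
  ⟨LinearMap.ker (Finsupp.linearCombination Γ (id : M → M)), M →₀ Γ, inferInstance, inferInstance,
    inferInstance, inferInstance, inferInstance, inferInstance, inferInstance, inferInstance,
    Submodule.subtype _, Finsupp.linearCombination Γ id, Submodule.injective_subtype _,
    LinearMap.exact_subtype_ker_map _, Finsupp.linearCombination_id_surjective Γ M, inferInstance,
    c.projective_finsupp M, c.dualSurjective_finsupp M⟩

/-- One degree is lost because `DualSurjective` itself uses up the vanishing of `Ext^1`. In the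
induction it is needed for the syzygy `K`, to pass from extending `Γ`-forms to extending `B`-forms.
-/
theorem dualSurjective_and_extVanishesUpTo (k : ℕ) :
    ∀ (M : Type u) [AddCommGroup M] [Module B M] [Module Γ M] [IsScalarTower B Γ M],
      ExtVanishesUpTo Γ M Γ (k + 1) → c.DualSurjective M ∧ ExtVanishesUpTo B M B k := by
  induction k with
  | zero =>
    intro M _ _ _ _ hM
    obtain ⟨K, P, _, _, _, _, _, _, _, _, f, g, hf, he, hg, _, _, hP⟩ := c.exists_presentation M
    have := (extVanishesUpTo_succ_iff hf he hg 0 (extVanishesUpTo_of_projective _)).1 hM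
    exact ⟨c.dualSurjective_of_extension he hg hP this.2, fun i hi hi' => by omega⟩
  | succ k ih =>
    intro M _ _ _ _ hM
    obtain ⟨K, P, _, _, _, _, _, _, _, _, f, g, hf, he, hg, _, _, hP⟩ := c.exists_presentation M
    obtain ⟨hK, hext⟩ :=
      (extVanishesUpTo_succ_iff hf he hg (k + 1) (extVanishesUpTo_of_projective _)).1 hM
    obtain ⟨hKd, hKB⟩ := ih K hK
    exact ⟨c.dualSurjective_of_extension he hg hP hext,
      (extVanishesUpTo_succ_iff (f := f.restrictScalars B) (g := g.restrictScalars B) hf he hg k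
        (extVanishesUpTo_of_projective _)).2 ⟨hKB, c.extension_of_dualSurjective hKd hext⟩⟩

/-- No degree is lost here: extension of `B`-forms makes `DualSurjective` pass from `P` to the
syzygy, so the induction continues. -/
theorem extVanishesUpTo_of_dualSurjective (k : ℕ) :
    ∀ (M : Type u) [AddCommGroup M] [Module B M] [Module Γ M] [IsScalarTower B Γ M],
      c.DualSurjective M → ExtVanishesUpTo B M B k → ExtVanishesUpTo Γ M Γ k := by
  induction k with
  | zero => intro M _ _ _ _ _ _ i hi hi'; omega
  | succ k ih =>
    intro M _ _ _ _ hd hM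
    obtain ⟨K, P, _, _, _, _, _, _, _, _, f, g, hf, he, hg, _, _, hP⟩ := c.exists_presentation M
    obtain ⟨hK, hext⟩ := (extVanishesUpTo_succ_iff (f := f.restrictScalars B)
      (g := g.restrictScalars B) hf he hg k (extVanishesUpTo_of_projective _)).1 hM
    exact (extVanishesUpTo_succ_iff hf he hg k (extVanishesUpTo_of_projective _)).2
      ⟨ih K (c.dualSurjective_left_of_extension hP hext) hK,
        c.triangular_extension he hg hd hext⟩

/-- A module over a ring of triangular matrices is semi-Gorenstein-projective if and only if
the underlying module over the base ring is so and the dual of the structure map is surjective. -/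
theorem isSemiGorensteinProjective_iff (M : Type u) [AddCommGroup M] [Module B M] [Module Γ M]
    [IsScalarTower B Γ M] :
    IsSemiGorensteinProjective Γ M ↔ IsSemiGorensteinProjective B M ∧ c.DualSurjective M := by
  simp only [isSemiGorensteinProjective_iff_extVanishesUpTo]
  exact ⟨fun h => ⟨fun k => (c.dualSurjective_and_extVanishesUpTo k M (h (k + 1))).2,
    (c.dualSurjective_and_extVanishesUpTo 0 M (h 1)).1⟩,
    fun h k => c.extVanishesUpTo_of_dualSurjective k M h.2 (h.1 k)⟩

end TriangularCoordinates

open MulOpposite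

/-! ### `T₂(A)` and its opposite as triangular rings -/

section UpperTriangular

variable (A : Type u) [Ring A]

/-- The diagonal embedding of `A` into the upper triangular matrices. -/
def upperTriangularDiagonal : A →+* upperTriangularTwo A :=
  (Matrix.scalar (Fin 2)).codRestrict (upperTriangularTwo A) (fun a => by
    change (Matrix.scalar (Fin 2) a) 1 0 = 0
    simp)

instance : Module A (upperTriangularTwo A) :=
  Module.compHom _ (upperTriangularDiagonal A)

instance : Module Aᵐᵒᵖ (upperTriangularTwo A) :=
  Module.compHom _ (upperTriangularDiagonal A).op

variable {A}

theorem upperTriangular_smul_def (a : A) (x : upperTriangularTwo A) :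
    a • x = upperTriangularDiagonal A a * x := rfl

theorem upperTriangular_op_smul_def (a : A) (x : upperTriangularTwo A) :
    op a • x = x * upperTriangularDiagonal A a := rfl

instance : IsScalarTower A (upperTriangularTwo A) (upperTriangularTwo A) :=
  ⟨fun a x y => by simp [upperTriangular_smul_def, mul_assoc]⟩

instance : SMulCommClass (upperTriangularTwo A) Aᵐᵒᵖ (upperTriangularTwo A) :=
  ⟨fun x a y => by
    induction a with
    | h a => simp [upperTriangular_op_smul_def, mul_assoc]⟩

instance : IsScalarTower Aᵐᵒᵖ (upperTriangularTwo A)ᵐᵒᵖ (upperTriangularTwo A) :=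
  ⟨fun a x y => by
    induction a with
    | h a =>
      induction x with
      | h x =>
        rw [← op_smul, upperTriangular_op_smul_def, upperTriangular_op_smul_def, op_smul_eq_mul,
          op_smul_eq_mul, mul_assoc]⟩

instance : IsScalarTower Aᵐᵒᵖ (upperTriangularTwo A)ᵐᵒᵖ (upperTriangularTwo A)ᵐᵒᵖ :=
  ⟨fun a x y => by
    induction a with
    | h a =>
      induction x with
      | h x =>
        induction y with
        | h y => exact congrArg op (smul_assoc (op a) (op x) y)⟩

@[simp] theorem upperTriangular_one_zero (x : upperTriangularTwo A) : x.1 1 0 = 0 := x.2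

variable (A) in
/-- The matrix entries, as a left linear equivalence. -/
def upperTriangularEntries : upperTriangularTwo A ≃ₗ[A] A × A × A where
  toFun x := (x.1 0 0, x.1 0 1, x.1 1 1)
  invFun t := ⟨!![t.1, t.2.1; 0, t.2.2], by
    change (!![t.1, t.2.1; 0, t.2.2] : Matrix (Fin 2) (Fin 2) A) 1 0 = 0
    simp⟩
  map_add' x y := rfl
  map_smul' a x := by
    simp [upperTriangular_smul_def, upperTriangularDiagonal]
  left_inv x := by
    ext i j
    fin_cases i <;> fin_cases j <;> simp
  right_inv t := by simp

theorem upperTriangularEntries_apply (x : upperTriangularTwo A) :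
    upperTriangularEntries A x = (x.1 0 0, x.1 0 1, x.1 1 1) := rfl

variable (A) in
/-- The matrix entries, as coordinates on the ring of upper triangular matrices. -/
def upperTriangularCoordinates : TriangularCoordinates A (upperTriangularTwo A) where
  coord := upperTriangularEntries A
  coord_one := by simp [upperTriangularEntries_apply]
  coord_mul x y := by
    simp [upperTriangularEntries_apply, Matrix.mul_apply]

theorem upperTriangularCoordinates_op_smul (a : A) (x : upperTriangularTwo A) :
    (upperTriangularCoordinates A).coord (op a • x) =
      op a • (upperTriangularCoordinates A).coord x := by
  simp [upperTriangularCoordinates, upperTriangularEntries_apply, upperTriangular_op_smul_def,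
    upperTriangularDiagonal]

variable (A) in
/-- The matrix entries, as right linear maps on the ring of upper triangular matrices. -/
def upperTriangularRightCoord : upperTriangularTwo A ≃ₗ[Aᵐᵒᵖ] A × A × A where
  __ := (upperTriangularCoordinates A).coord.toAddEquiv
  map_smul' a x := upperTriangularCoordinates_op_smul a.unop x

variable (A) in
/-- The opposite of the ring of upper triangular matrices over `A` is the ring of upper triangular
matrices over the opposite of `A`, through transposition along the antidiagonal. -/
def upperTriangularOpCoordinates :
    TriangularCoordinates Aᵐᵒᵖ (upperTriangularTwo A)ᵐᵒᵖ where
  coord :=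
    { toFun := fun x => (op ((upperTriangularRightCoord A x.unop).2.2),
        op ((upperTriangularRightCoord A x.unop).2.1), op ((upperTriangularRightCoord A x.unop).1))
      invFun := fun t => op ((upperTriangularRightCoord A).symm
        (t.2.2.unop, t.2.1.unop, t.1.unop))
      map_add' := fun x y => by simp
      map_smul' := fun a x => by simp
      left_inv := fun x => by simp
      right_inv := fun t => by simp }
  coord_one := by
    have : upperTriangularRightCoord A 1 = (1, 0, 1) := (upperTriangularCoordinates A).coord_one
    simp [this]
  coord_mul x y := by
    have h := (upperTriangularCoordinates A).coord_mul y.unop x.unop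
    have h' : upperTriangularRightCoord A (y.unop * x.unop) =
        (upperTriangularCoordinates A).coord (y.unop * x.unop) := rfl
    simp only [LinearEquiv.coe_mk, LinearMap.coe_mk, AddHom.coe_mk, unop_mul, h', h]
    simp only [op_mul, add_comm]
    rfl

theorem upperTriangularOpCoordinates_n :
    (upperTriangularOpCoordinates A).n = op (upperTriangularCoordinates A).n := rfl

/-- Antidiagonal transposition exchanges the diagonal idempotents: on a right module `N`,
multiplication by `n` goes from `Np` to `Nq`. -/
theorem upperTriangularOpCoordinates_q :
    (upperTriangularOpCoordinates A).q = op (upperTriangularCoordinates A).p := rfl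

end UpperTriangular

theorem isSemiGorensteinProjective_iff_of_submodules {S W : Type u} [Ring S] [AddCommGroup W]
    [Module S W] {X Y Z : Submodule S W} (hXY : X ≤ Y) (g : Y →ₗ[S] Z)
    (h : Function.Exact (Submodule.inclusion hXY) g) (hg : Function.Surjective g)
    (hY : IsSemiGorensteinProjective S Y) :
    IsSemiGorensteinProjective S Z ↔ IsSemiGorensteinProjective S X ∧
      ∀ u : X →ₗ[S] S, ∃ w : Y →ₗ[S] S, w ∘ₗ Submodule.inclusion hXY = u :=
  isSemiGorensteinProjective_iff_of_shortExact (Submodule.inclusion_injective hXY) h hg hY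

/-! ### The dual of a `T₂(A)`-module -/

section Dual

variable {A : Type u} [Ring A] {M : Type u} [AddCommGroup M] [Module A M]
  [Module (upperTriangularTwo A) M] [IsScalarTower A (upperTriangularTwo A) M]

local notation "Λ" => upperTriangularTwo A
local notation "cA" => upperTriangularCoordinates A

variable (A M)

/-- The linear forms on `M` vanishing on `q M`, that is, the dual of `p M`. -/
def dualP : Submodule Aᵐᵒᵖ (LeftDual A M) where
  carrier := {v | ∀ m, v ((cA).q • m) = 0}
  add_mem' hv hw m := by simp [hv m, hw m]
  zero_mem' m := rfl
  smul_mem' a v hv m := by simp [hv m]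

/-- The linear forms on `M` vanishing on `p M`, that is, the dual of `q M`. -/
def dualQ : Submodule Aᵐᵒᵖ (LeftDual A M) where
  carrier := {v | ∀ m, v ((cA).p • m) = 0}
  add_mem' hv hw m := by simp [hv m, hw m]
  zero_mem' m := rfl
  smul_mem' a v hv m := by simp [hv m]

/-- The linear forms on `M` vanishing on `q M` and on `n M`, that is, the dual of the cokernel of
`n : q M → p M`. -/
def dualCoker : Submodule Aᵐᵒᵖ (LeftDual A M) where
  carrier := {v | (∀ m, v ((cA).q • m) = 0) ∧ ∀ m, v ((cA).n • m) = 0}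
  add_mem' hv hw := ⟨fun m => by simp [hv.1 m, hw.1 m], fun m => by simp [hv.2 m, hw.2 m]⟩
  zero_mem' := ⟨fun m => rfl, fun m => rfl⟩
  smul_mem' a v hv := ⟨fun m => by simp [hv.1 m], fun m => by simp [hv.2 m]⟩

theorem dualCoker_le_dualP : dualCoker A M ≤ dualP A M := fun _ h => h.1

/-- The dual of the structure map `n : q M → p M`. -/
def dualN : dualP A M →ₗ[Aᵐᵒᵖ] dualQ A M where
  toFun v := ⟨v.1 ∘ₗ (cA).nMap M, fun m => by simp⟩
  map_add' _ _ := rfl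
  map_smul' _ _ := rfl

/-- The projection of the dual of `M` to the dual of `p M`. -/
def toDualP : LeftDual A M →ₗ[Aᵐᵒᵖ] dualP A M where
  toFun w := ⟨w ∘ₗ (cA).pMap M, fun m => by simp⟩
  map_add' _ _ := rfl
  map_smul' _ _ := rfl

/-- The projection of the dual of `M` to the dual of `q M`. -/
def toDualQ : LeftDual A M →ₗ[Aᵐᵒᵖ] dualQ A M where
  toFun w := ⟨w ∘ₗ (cA).qMap M, fun m => by simp⟩
  map_add' _ _ := rfl
  map_smul' _ _ := rfl

variable {A M}

@[simp] theorem dualN_apply (v : dualP A M) (m : M) :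
    (dualN A M v).1 m = v.1 ((cA).n • m) := rfl
@[simp] theorem toDualP_apply (w : LeftDual A M) (m : M) :
    (toDualP A M w).1 m = w ((cA).p • m) := rfl
@[simp] theorem toDualQ_apply (w : LeftDual A M) (m : M) :
    (toDualQ A M w).1 m = w ((cA).q • m) := rfl

theorem toDualP_add_toDualQ (w : LeftDual A M) :
    (toDualP A M w).1 + (toDualQ A M w).1 = w := by
  ext m
  rw [LinearMap.add_apply, toDualP_apply, toDualQ_apply, ← map_add,
    TriangularCoordinates.p_smul_add_q_smul]

theorem toDualP_of_mem (v : dualP A M) : toDualP A M v.1 = v := by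
  refine Subtype.ext (LinearMap.ext fun m => ?_)
  exact (cA).map_p_smul v.2 m

theorem toDualQ_of_mem_dualP (v : dualP A M) : toDualQ A M v.1 = 0 :=
  Subtype.ext (LinearMap.ext fun m => v.2 m)

theorem toDualP_of_mem_dualQ (v : dualQ A M) : toDualP A M v.1 = 0 :=
  Subtype.ext (LinearMap.ext fun m => v.2 m)

theorem toDualQ_of_mem (v : dualQ A M) : toDualQ A M v.1 = v := by
  have h := toDualP_add_toDualQ v.1
  rw [toDualP_of_mem_dualQ] at h
  exact Subtype.ext (by simpa using h)

variable (A M) in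
/-- The decomposition of the dual of `M` induced by `M = p M ⊕ q M`. -/
def dualDecomposition : LeftDual A M ≃ₗ[Aᵐᵒᵖ] dualP A M × dualQ A M where
  __ := (toDualP A M).prod (toDualQ A M)
  invFun t := t.1.1 + t.2.1
  left_inv w := toDualP_add_toDualQ w
  right_inv t := by
    refine Prod.ext ?_ ?_ <;>
    simp [toDualP_of_mem, toDualQ_of_mem, toDualP_of_mem_dualQ, toDualQ_of_mem_dualP]

theorem dualN_surjective (h : (cA).DualSurjective M) : Function.Surjective (dualN A M) := by
  intro w
  obtain ⟨v, hv, hvn⟩ := h.exists_of_q w.1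
  refine ⟨⟨v, hv⟩, ?_⟩
  rw [← toDualQ_of_mem w]
  exact Subtype.ext (LinearMap.ext fun m => hvn m)

theorem exact_inclusion_dualN :
    Function.Exact (Submodule.inclusion (dualCoker_le_dualP A M)) (dualN A M) := by
  intro v
  constructor
  · intro h
    exact ⟨⟨v.1, v.2, fun m => LinearMap.congr_fun (congrArg Subtype.val h) m⟩, rfl⟩
  · rintro ⟨u, rfl⟩
    exact Subtype.ext (LinearMap.ext fun m => u.2.2 m)

instance : IsScalarTower Aᵐᵒᵖ Λᵐᵒᵖ (LeftDual Λ M) :=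
  ⟨fun a x φ => LinearMap.ext fun m => smul_assoc a x (φ m)⟩

variable (A M) in
/-- The dual of a `T₂(A)`-module as a right `A`-module. -/
def triangularDualEquiv : LeftDual Λ M ≃ₗ[Aᵐᵒᵖ] dualCoker A M × dualP A M where
  toFun φ := (⟨(cA).diagEntry φ, (cA).diagEntry_q φ, (cA).diagEntry_n φ⟩,
    ⟨(cA).offDiagEntry φ, (cA).offDiagEntry_q φ⟩)
  invFun t := (cA).homOfPair t.1.1 t.2.1 t.1.2.1 t.1.2.2 t.2.2
  map_add' φ ψ := by
    refine Prod.ext (Subtype.ext (LinearMap.ext fun m => ?_))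
      (Subtype.ext (LinearMap.ext fun m => ?_)) <;>
    simp [TriangularCoordinates.diagEntry, TriangularCoordinates.offDiagEntry]
  map_smul' a φ := by
    refine Prod.ext (Subtype.ext (LinearMap.ext fun m => ?_))
      (Subtype.ext (LinearMap.ext fun m => ?_))
    · exact congrArg Prod.fst (upperTriangularCoordinates_op_smul a.unop (φ m))
    · exact congrArg (fun t => t.2.1) (upperTriangularCoordinates_op_smul a.unop (φ m))
  left_inv φ := (cA).hom_ext (TriangularCoordinates.diagEntry_homOfPair _ _ _ _ _ _)
    (TriangularCoordinates.offDiagEntry_homOfPair _ _ _ _ _ _)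
  right_inv t := by
    refine Prod.ext (Subtype.ext ?_) (Subtype.ext ?_)
    · exact TriangularCoordinates.diagEntry_homOfPair _ _ _ _ _ _
    · exact TriangularCoordinates.offDiagEntry_homOfPair _ _ _ _ _ _

theorem coord_triangularDualEquiv (φ : LeftDual Λ M) (m : M) :
    (cA).coord (φ m) = ((triangularDualEquiv A M φ).1.1 m, (triangularDualEquiv A M φ).2.1 m,
      (triangularDualEquiv A M φ).2.1 ((cA).n • m)) :=
  (cA).coord_apply φ m

theorem triangularDualEquiv_op_smul (x : Λ) (φ : LeftDual Λ M) :
    triangularDualEquiv A M (op x • φ) =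
      (op ((cA).coord x).1 • (triangularDualEquiv A M φ).1,
        op ((cA).coord x).2.1 •
            Submodule.inclusion (dualCoker_le_dualP A M) (triangularDualEquiv A M φ).1 +
          op ((cA).coord x).2.2 • (triangularDualEquiv A M φ).2) := by
  refine Prod.ext (Subtype.ext (LinearMap.ext fun m => ?_))
    (Subtype.ext (LinearMap.ext fun m => ?_))
  · exact congrArg Prod.fst ((cA).coord_mul (φ m) x)
  · exact congrArg (fun t => t.2.1) ((cA).coord_mul (φ m) x)

theorem triangularDualEquiv_n_smul (φ : LeftDual Λ M) :
    triangularDualEquiv A M (op (cA).n • φ) =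
      (0, Submodule.inclusion (dualCoker_le_dualP A M) (triangularDualEquiv A M φ).1) := by
  rw [triangularDualEquiv_op_smul, TriangularCoordinates.coord_n]
  simp only [op_zero, op_one, zero_smul, one_smul, add_zero]

theorem triangularDualEquiv_p_smul (φ : LeftDual Λ M) :
    triangularDualEquiv A M (op (cA).p • φ) = ((triangularDualEquiv A M φ).1, 0) := by
  rw [triangularDualEquiv_op_smul, TriangularCoordinates.coord_p]
  simp only [op_zero, op_one, zero_smul, one_smul, add_zero]

theorem triangularDualEquiv_q_smul (φ : LeftDual Λ M) :
    triangularDualEquiv A M (op (cA).q • φ) = (0, (triangularDualEquiv A M φ).2) := by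
  rw [triangularDualEquiv_op_smul, TriangularCoordinates.coord_q]
  simp only [op_zero, op_one, zero_smul, one_smul, zero_add]

/-- Right multiplication by `n` on the dual is the inclusion of `dualCoker` in `dualP`, so pulling
forms back along it is restricting them. -/
theorem dualSurjective_leftDual_iff :
    (upperTriangularOpCoordinates A).DualSurjective (LeftDual Λ M) ↔
      ∀ u : dualCoker A M →ₗ[Aᵐᵒᵖ] Aᵐᵒᵖ, ∃ w : dualP A M →ₗ[Aᵐᵒᵖ] Aᵐᵒᵖ,
        w ∘ₗ Submodule.inclusion (dualCoker_le_dualP A M) = u := by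
  let e := triangularDualEquiv A M
  constructor
  · intro H u
    obtain ⟨v, hv⟩ := H (u ∘ₗ LinearMap.fst _ _ _ ∘ₗ e.toLinearMap)
    refine ⟨v ∘ₗ e.symm.toLinearMap ∘ₗ LinearMap.inr _ _ _, LinearMap.ext fun x => ?_⟩
    have h := hv (e.symm (x, 0))
    rw [upperTriangularOpCoordinates_n, upperTriangularOpCoordinates_q] at h
    have h₁ : op (cA).n • e.symm (x, 0) =
        e.symm (0, Submodule.inclusion (dualCoker_le_dualP A M) x) := by
      rw [LinearEquiv.eq_symm_apply, triangularDualEquiv_n_smul, e.apply_symm_apply]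
    have h₂ : e (op (cA).p • e.symm (x, 0)) = (x, 0) := by
      rw [triangularDualEquiv_p_smul, e.apply_symm_apply]
    rw [h₁] at h
    simp only [LinearMap.comp_apply, LinearEquiv.coe_coe, h₂] at h
    exact h
  · intro H h
    obtain ⟨w, hw⟩ := H (h ∘ₗ e.symm.toLinearMap ∘ₗ LinearMap.inl _ _ _)
    refine ⟨w ∘ₗ LinearMap.snd _ _ _ ∘ₗ e.toLinearMap, fun φ => ?_⟩
    rw [upperTriangularOpCoordinates_n, upperTriangularOpCoordinates_q]
    have h₁ : op (cA).p • φ = e.symm ((e φ).1, 0) := by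
      rw [LinearEquiv.eq_symm_apply, triangularDualEquiv_p_smul]
    have h₂ := LinearMap.congr_fun hw (e φ).1
    rw [h₁]
    simp only [LinearMap.comp_apply, LinearEquiv.coe_coe] at h₂ ⊢
    rw [triangularDualEquiv_n_smul]
    exact h₂

theorem isSemiGorensteinProjective_dualQ_iff (h : (cA).DualSurjective M)
    (hP : IsSemiGorensteinProjective Aᵐᵒᵖ (dualP A M)) :
    IsSemiGorensteinProjective Aᵐᵒᵖ (dualQ A M) ↔
      IsSemiGorensteinProjective Aᵐᵒᵖ (dualCoker A M) ∧
        ∀ u : dualCoker A M →ₗ[Aᵐᵒᵖ] Aᵐᵒᵖ, ∃ w : dualP A M →ₗ[Aᵐᵒᵖ] Aᵐᵒᵖ,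
          w ∘ₗ Submodule.inclusion (dualCoker_le_dualP A M) = u :=
  isSemiGorensteinProjective_iff_of_submodules (dualCoker_le_dualP A M) (dualN A M)
    exact_inclusion_dualN (dualN_surjective h) hP

theorem isSemiGorensteinProjective_leftDual_iff :
    IsSemiGorensteinProjective Aᵐᵒᵖ (LeftDual A M) ↔
      IsSemiGorensteinProjective Aᵐᵒᵖ (dualP A M) ∧
        IsSemiGorensteinProjective Aᵐᵒᵖ (dualQ A M) :=
  Iff.trans ⟨fun h => h.of_equiv (dualDecomposition A M),
    fun h => h.of_equiv (dualDecomposition A M).symm⟩ isSemiGorensteinProjective_prod_iff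

theorem isSemiGorensteinProjective_triangular_leftDual_iff :
    IsSemiGorensteinProjective Aᵐᵒᵖ (LeftDual Λ M) ↔
      IsSemiGorensteinProjective Aᵐᵒᵖ (dualCoker A M) ∧
        IsSemiGorensteinProjective Aᵐᵒᵖ (dualP A M) :=
  Iff.trans ⟨fun h => h.of_equiv (triangularDualEquiv A M),
    fun h => h.of_equiv (triangularDualEquiv A M).symm⟩ isSemiGorensteinProjective_prod_iff

/-- Over `Λ` the condition concerns `dualCoker`, `dualP` and extension of forms between them; over
`A` it concerns `dualP` and `dualQ`. Once `dualP` is semi-Gorenstein-projective, the exact sequence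
trades `dualQ` for the other two requirements. -/
theorem isRightSemiGorensteinProjective_leftDual_iff (h : (cA).DualSurjective M) :
    IsRightSemiGorensteinProjective Λ (LeftDual Λ M) ↔
      IsRightSemiGorensteinProjective A (LeftDual A M) := by
  rw [isRightSemiGorensteinProjective_iff, isRightSemiGorensteinProjective_iff,
    (upperTriangularOpCoordinates A).isSemiGorensteinProjective_iff, dualSurjective_leftDual_iff,
    isSemiGorensteinProjective_leftDual_iff, isSemiGorensteinProjective_triangular_leftDual_iff]
  have key := isSemiGorensteinProjective_dualQ_iff h
  tauto

/-- A `T₂(A)`-module is double semi-Gorenstein-projective if and only if the underlying `A`-module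
is so and the dual of the structure map is surjective. -/
theorem isDoubleSemiGorensteinProjective_iff :
    IsDoubleSemiGorensteinProjective Λ M ↔
      IsDoubleSemiGorensteinProjective A M ∧ (cA).DualSurjective M := by
  unfold IsDoubleSemiGorensteinProjective
  rw [(cA).isSemiGorensteinProjective_iff]
  constructor
  · rintro ⟨⟨h₁, h₂⟩, h₃⟩
    exact ⟨⟨h₁, (isRightSemiGorensteinProjective_leftDual_iff h₂).1 h₃⟩, h₂⟩
  · rintro ⟨⟨h₁, h₃⟩, h₂⟩
    exact ⟨⟨h₁, h₂⟩, (isRightSemiGorensteinProjective_leftDual_iff h₂).2 h₃⟩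

end Dual

/-! ### Comparison of the canonical maps over `A` and `T₂(A)` -/

section CanonicalMap

variable {A : Type u} [Ring A] {M : Type u} [AddCommGroup M] [Module A M]
  [Module (upperTriangularTwo A) M] [IsScalarTower A (upperTriangularTwo A) M]

local notation "Λ" => upperTriangularTwo A
local notation "cA" => upperTriangularCoordinates A

@[simp] theorem canonicalMap_apply {S N : Type u} [Ring S] [AddCommGroup N] [Module S N] (m : N)
    (f : LeftDual S N) : canonicalMap S N m f = f m := rfl

theorem canonicalMap_eq_zero_iff (h : (cA).DualSurjective M) (m : M) :
    canonicalMap Λ M m = 0 ↔ canonicalMap A M m = 0 := by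
  constructor
  · intro hm
    -- The maps with zero diagonal entry suffice: they test `m` against `dualP` and, as `dualN` is
    -- onto, also against `dualQ`.
    have key : ∀ t : dualP A M, t.1 m = 0 ∧ t.1 ((cA).n • m) = 0 := by
      intro t
      have h₁ := coord_triangularDualEquiv ((triangularDualEquiv A M).symm (0, t)) m
      have h₂ : (triangularDualEquiv A M).symm (0, t) m = 0 :=
        LinearMap.congr_fun hm ((triangularDualEquiv A M).symm (0, t))
      rw [h₂, map_zero, LinearEquiv.apply_symm_apply] at h₁
      exact ⟨(congrArg (fun x => x.2.1) h₁).symm, (congrArg (fun x => x.2.2) h₁).symm⟩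
    refine LinearMap.ext fun w => ?_
    obtain ⟨v, hv⟩ := dualN_surjective h (toDualQ A M w)
    have h₁ := (key v).2
    rw [← dualN_apply, hv] at h₁
    have h₂ := LinearMap.congr_fun (toDualP_add_toDualQ w) m
    rw [LinearMap.add_apply, (key (toDualP A M w)).1, h₁, add_zero] at h₂
    exact h₂.symm
  · intro hm
    have key : ∀ w : LeftDual A M, w m = 0 := fun w => LinearMap.congr_fun hm w
    refine LinearMap.ext fun φ => (cA).coord.injective ?_
    have h₁ : (triangularDualEquiv A M φ).2.1 ((cA).n • m) = 0 :=
      key (dualN A M (triangularDualEquiv A M φ).2).1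
    rw [canonicalMap_apply, coord_triangularDualEquiv, key, key, h₁]
    exact (map_zero _).symm

theorem canonicalMap_injective_iff (h : (cA).DualSurjective M) :
    Function.Injective (canonicalMap Λ M) ↔ Function.Injective (canonicalMap A M) := by
  simp only [injective_iff_map_eq_zero, canonicalMap_eq_zero_iff h]

/-- The linear form on the dual of `M` as a `T₂(A)`-module induced by a linear form on the dual of
`M` as an `A`-module. -/
def triangularBidual (G : RightDual A (LeftDual A M)) : RightDual Λ (LeftDual Λ M) where
  toFun φ := (cA).coord.symm (G (triangularDualEquiv A M φ).1.1, G (triangularDualEquiv A M φ).2.1,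
    G (dualN A M (triangularDualEquiv A M φ).2).1)
  map_add' φ ψ := (cA).coord.injective (by simp)
  map_smul' x φ := by
    induction x with
    | h x =>
      apply (cA).coord.injective
      have h₁ : dualN A M (Submodule.inclusion (dualCoker_le_dualP A M)
          (triangularDualEquiv A M φ).1) = 0 := exact_inclusion_dualN.apply_apply_eq_zero _
      rw [RingHom.id_apply, op_smul_eq_mul, TriangularCoordinates.coord_mul,
        triangularDualEquiv_op_smul, map_add, map_smul, map_smul, h₁, smul_zero, zero_add]
      simp only [LinearEquiv.apply_symm_apply, Submodule.coe_smul, Submodule.coe_add, map_add,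
        map_smul, op_smul_eq_mul, Submodule.coe_inclusion]

theorem coord_triangularBidual (G : RightDual A (LeftDual A M)) (φ : LeftDual Λ M) :
    (cA).coord (triangularBidual G φ) = (G (triangularDualEquiv A M φ).1.1,
      G (triangularDualEquiv A M φ).2.1, G (dualN A M (triangularDualEquiv A M φ).2).1) :=
  (cA).coord.apply_symm_apply _

theorem canonicalMap_surjective_of_triangular (h : (cA).DualSurjective M)
    (hs : Function.Surjective (canonicalMap Λ M)) : Function.Surjective (canonicalMap A M) := by
  intro G
  obtain ⟨m, hm⟩ := hs (triangularBidual G)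
  have key : ∀ t : dualP A M, t.1 m = G t.1 ∧ (dualN A M t).1 m = G (dualN A M t).1 := by
    intro t
    have h₁ := coord_triangularDualEquiv ((triangularDualEquiv A M).symm (0, t)) m
    have h₂ : (triangularDualEquiv A M).symm (0, t) m =
      triangularBidual G ((triangularDualEquiv A M).symm (0, t)) :=
        LinearMap.congr_fun hm ((triangularDualEquiv A M).symm (0, t))
    rw [h₂, coord_triangularBidual, LinearEquiv.apply_symm_apply] at h₁
    exact ⟨(congrArg (fun x => x.2.1) h₁).symm, (congrArg (fun x => x.2.2) h₁).symm⟩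
  refine ⟨m, LinearMap.ext fun w => ?_⟩
  obtain ⟨v, hv⟩ := dualN_surjective h (toDualQ A M w)
  have h₁ := (key v).2
  rw [hv] at h₁
  have h₂ := LinearMap.congr_fun (toDualP_add_toDualQ w) m
  rw [LinearMap.add_apply, (key (toDualP A M w)).1, h₁, ← map_add, toDualP_add_toDualQ] at h₂
  exact h₂.symm

theorem coord_bidual_smul (F : RightDual Λ (LeftDual Λ M)) (x : Λ) (φ : LeftDual Λ M) :
    (cA).coord (F (op x • φ)) = (((cA).coord (F φ)).1 * ((cA).coord x).1,
      ((cA).coord (F φ)).1 * ((cA).coord x).2.1 + ((cA).coord (F φ)).2.1 * ((cA).coord x).2.2,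
      ((cA).coord (F φ)).2.2 * ((cA).coord x).2.2) := by
  rw [map_smul, op_smul_eq_mul, TriangularCoordinates.coord_mul]

/-- The coordinates of a linear form on the dual of `M` as a `T₂(A)`-module, restricted to the dual
of `p M`. -/
def bidualCoord (F : RightDual Λ (LeftDual Λ M)) : dualP A M →ₗ[Aᵐᵒᵖ] A × A × A :=
  (upperTriangularRightCoord A).toLinearMap ∘ₗ F.restrictScalars Aᵐᵒᵖ ∘ₗ
    (triangularDualEquiv A M).symm.toLinearMap ∘ₗ LinearMap.inr _ _ _

theorem bidualCoord_apply (F : RightDual Λ (LeftDual Λ M)) (t : dualP A M) :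
    bidualCoord F t = (cA).coord (F ((triangularDualEquiv A M).symm (0, t))) := rfl

/-- The first entry of `F φ` is the off-diagonal entry of `F (φ n)`, and the second column of `F φ`
is that of `F (φ q)`. Both `φ n` and `φ q` have zero diagonal part, so `F` is determined by its
values on `dualP`. -/
theorem coord_bidual (F : RightDual Λ (LeftDual Λ M)) (φ : LeftDual Λ M) :
    (cA).coord (F φ) = ((bidualCoord F (Submodule.inclusion (dualCoker_le_dualP A M)
        (triangularDualEquiv A M φ).1)).2.1, (bidualCoord F (triangularDualEquiv A M φ).2).2.1,
      (bidualCoord F (triangularDualEquiv A M φ).2).2.2) := by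
  rw [bidualCoord_apply, bidualCoord_apply, ← triangularDualEquiv_n_smul,
    ← triangularDualEquiv_q_smul, LinearEquiv.symm_apply_apply, LinearEquiv.symm_apply_apply,
    coord_bidual_smul, coord_bidual_smul, TriangularCoordinates.coord_n,
    TriangularCoordinates.coord_q]
  simp

theorem bidualCoord_coker (F : RightDual Λ (LeftDual Λ M)) (u : dualCoker A M) :
    (bidualCoord F (Submodule.inclusion (dualCoker_le_dualP A M) u)).2.2 = 0 := by
  have h := triangularDualEquiv_n_smul ((triangularDualEquiv A M).symm (u, 0))
  rw [LinearEquiv.apply_symm_apply] at h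
  rw [bidualCoord_apply, ← h, LinearEquiv.symm_apply_apply, coord_bidual_smul,
    TriangularCoordinates.coord_n]
  simp

theorem exists_comp_dualN (h : (cA).DualSurjective M) (g : dualP A M →ₗ[Aᵐᵒᵖ] A)
    (hg : ∀ t, dualN A M t = 0 → g t = 0) :
    ∃ s : dualQ A M →ₗ[Aᵐᵒᵖ] A, ∀ t, s (dualN A M t) = g t :=
  LinearMap.exists_comp_eq_of_surjective (S := Aᵐᵒᵖ) (P := dualP A M) (M := dualQ A M) (C := A)
    (dualN_surjective h) g hg

/-- The off-diagonal part of `bidualCoord`. -/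
def bidualOffDiag (F : RightDual Λ (LeftDual Λ M)) : dualP A M →ₗ[Aᵐᵒᵖ] A :=
  LinearMap.fst Aᵐᵒᵖ A A ∘ₗ LinearMap.snd Aᵐᵒᵖ A (A × A) ∘ₗ bidualCoord F

/-- The second diagonal part of `bidualCoord`. -/
def bidualDiag (F : RightDual Λ (LeftDual Λ M)) : dualP A M →ₗ[Aᵐᵒᵖ] A :=
  LinearMap.snd Aᵐᵒᵖ A A ∘ₗ LinearMap.snd Aᵐᵒᵖ A (A × A) ∘ₗ bidualCoord F

theorem bidualDiag_eq_zero (F : RightDual Λ (LeftDual Λ M)) (t : dualP A M)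
    (ht : dualN A M t = 0) : bidualDiag F t = 0 := by
  obtain ⟨u, hu⟩ := (exact_inclusion_dualN t).1 ht
  rw [← hu]
  exact bidualCoord_coker F u

theorem triangular_canonicalMap_surjective (h : (cA).DualSurjective M)
    (hs : Function.Surjective (canonicalMap A M)) : Function.Surjective (canonicalMap Λ M) := by
  intro F
  -- The diagonal part of `F` kills the kernel of `dualN`, so it factors through `dualQ`. With the
  -- off-diagonal part on `dualP`, this assembles an `A`-bidual element, and a preimage of it is a
  -- preimage of `F`.
  obtain ⟨g, hg⟩ := exists_comp_dualN h (bidualDiag F) (bidualDiag_eq_zero F)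
  obtain ⟨m, hm⟩ := hs (bidualOffDiag F ∘ₗ toDualP A M + g ∘ₗ toDualQ A M)
  have key₁ : ∀ t : dualP A M, t.1 m = bidualOffDiag F t := by
    intro t
    have := LinearMap.congr_fun hm t.1
    rw [canonicalMap_apply, LinearMap.add_apply, LinearMap.comp_apply, LinearMap.comp_apply,
      toDualP_of_mem, toDualQ_of_mem_dualP, map_zero, add_zero] at this
    exact this
  have key₂ : ∀ t : dualP A M, t.1 ((cA).n • m) = bidualDiag F t := by
    intro t
    have := LinearMap.congr_fun hm (dualN A M t).1
    rw [canonicalMap_apply, LinearMap.add_apply, LinearMap.comp_apply, LinearMap.comp_apply,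
      toDualP_of_mem_dualQ, toDualQ_of_mem, map_zero, zero_add, hg] at this
    exact this
  refine ⟨m, LinearMap.ext fun φ => (cA).coord.injective ?_⟩
  rw [canonicalMap_apply, coord_triangularDualEquiv, coord_bidual, key₂, key₁]
  exact congrArg (fun a => (a, _)) (key₁ (Submodule.inclusion (dualCoker_le_dualP A M)
    (triangularDualEquiv A M φ).1))

theorem canonicalMap_surjective_iff (h : (cA).DualSurjective M) :
    Function.Surjective (canonicalMap Λ M) ↔ Function.Surjective (canonicalMap A M) :=
  ⟨canonicalMap_surjective_of_triangular h, triangular_canonicalMap_surjective h⟩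

theorem isReflexiveModule_iff (h : (cA).DualSurjective M) :
    IsReflexiveModule Λ M ↔ IsReflexiveModule A M :=
  and_congr (canonicalMap_injective_iff h) (canonicalMap_surjective_iff h)

end CanonicalMap

/-! ### Passing modules between `A` and `T₂(A)` -/

section Transfer

variable {A : Type u} [Ring A] {M : Type u} [AddCommGroup M] [Module A M]
  [Module (upperTriangularTwo A) M] [IsScalarTower A (upperTriangularTwo A) M]

local notation "Λ" => upperTriangularTwo A
local notation "cA" => upperTriangularCoordinates A

theorem IsTorsionless.exists_injective_pi {S N : Type u} [Ring S] [AddCommGroup N] [Module S N]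
    (h : IsTorsionless S N) : ∃ (k : ℕ) (f : N →ₗ[S] (Fin k → S)), Function.Injective f := by
  obtain ⟨P, _, _, _, _, f, hf⟩ := h
  obtain ⟨k, π, s, -, hs, -⟩ := Module.Finite.exists_comp_eq_id_of_projective S P
  exact ⟨k, s ∘ₗ f, hs.comp hf⟩

theorem isTorsionless_of_injective_pi {S N ι : Type u} [Ring S] [AddCommGroup N] [Module S N]
    [Finite ι] {Q : Type u} [AddCommGroup Q] [Module S Q] [Module.Finite S Q]
    [Module.Projective S Q] (f : N →ₗ[S] (ι → Q)) (hf : Function.Injective f) :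
    IsTorsionless S N := by
  classical
  have := Fintype.ofFinite ι
  exact ⟨ι → Q, inferInstance, inferInstance, inferInstance,
    .of_equiv (DFinsupp.linearEquivFunOnFintype (R := S) (M := fun _ : ι => Q)), f, hf⟩

instance : Module.Projective A Λ := (cA).projective

instance : Module.Finite A Λ := Module.Finite.equiv (cA).coord.symm

theorem IsTorsionless.restrictScalars (h : IsTorsionless Λ M) : IsTorsionless A M := by
  obtain ⟨k, f, hf⟩ := h.exists_injective_pi
  -- `ULift` puts the index type, hence the product, in universe `u`.
  exact isTorsionless_of_injective_pi (ι := ULift (Fin k)) (Q := Λ)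
    ((LinearMap.funLeft A Λ ULift.down) ∘ₗ f.restrictScalars A)
    ((LinearMap.funLeft_injective_of_surjective A Λ _ ULift.down_surjective).comp hf)

variable (A) in
/-- The first diagonal entry, as a ring homomorphism. -/
def upperTriangularFst : Λ →+* A where
  toFun x := ((cA).coord x).1
  map_one' := by rw [(cA).coord_one]
  map_mul' x y := by rw [(cA).coord_mul]
  map_zero' := by rw [map_zero]; rfl
  map_add' x y := by rw [map_add]; rfl

theorem upperTriangularFst_apply (x : Λ) : upperTriangularFst A x = ((cA).coord x).1 := rfl

/-- Here `qM = 0`, so there is no form to extend and zero works. -/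
theorem dualSurjective_of_smul_eq (h : ∀ (x : Λ) (m : M), x • m = upperTriangularFst A x • m) :
    (cA).DualSurjective M :=
  fun w => ⟨0, fun m => by simp [h, upperTriangularFst_apply]⟩

theorem isTorsionless_of_smul_eq (h : ∀ (x : Λ) (m : M), x • m = upperTriangularFst A x • m)
    (hM : IsTorsionless A M) : IsTorsionless Λ M := by
  obtain ⟨k, f, hf⟩ := hM.exists_injective_pi
  -- The first column `Λp` is a copy of `A` on which `Λ` acts through the first diagonal entry.
  let j : M →ₗ[Λ] (ULift.{u} (Fin k) → Λ) :=
    { toFun := fun m i => (cA).coord.symm (f m i.down, 0, 0)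
      map_add' := fun m m' => funext fun i => (cA).coord.injective (by simp)
      map_smul' := fun x m => funext fun i => (cA).coord.injective (by
        simp [h, TriangularCoordinates.coord_mul, upperTriangularFst_apply]) }
  refine isTorsionless_of_injective_pi j fun m m' hm => hf (funext fun i => ?_)
  have := congrArg (fun x => ((cA).coord x).1) (congrFun hm ⟨i⟩)
  simpa [j] using this

theorem exists_upperTriangular_structure (A L : Type u) [Ring A] [AddCommGroup L] [Module A L] :
    ∃ (_ : Module (upperTriangularTwo A) L) (_ : IsScalarTower A (upperTriangularTwo A) L),
      ∀ (x : upperTriangularTwo A) (l : L), x • l = upperTriangularFst A x • l := by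
  let i : Module (upperTriangularTwo A) L := Module.compHom L (upperTriangularFst A)
  have hi : ∀ (x : upperTriangularTwo A) (l : L), x • l = upperTriangularFst A x • l :=
    fun _ _ => rfl
  exact ⟨i, ⟨fun a x l => by simp [hi, upperTriangularFst_apply, mul_smul]⟩, hi⟩

theorem exists_restricted_structure (A M : Type u) [Ring A] [AddCommGroup M]
    [Module (upperTriangularTwo A) M] :
    ∃ _ : Module A M, IsScalarTower A (upperTriangularTwo A) M := by
  let i : Module A M := Module.compHom M (upperTriangularDiagonal A)
  exact ⟨i, ⟨fun a x m => mul_smul (upperTriangularDiagonal A a) x m⟩⟩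

end Transfer

theorem theorem1p6 (R : Type v) [CommRing R] [IsArtinianRing R]
    (A : Type u) [Ring A] [Algebra R A] [Module.Finite R A] :
    ((∀ (L : Type u) [AddCommGroup L] [Module A L] [Module.Finite A L],
        IsTorsionless A L → IsDoubleSemiGorensteinProjective A L →
          IsGorensteinProjective A L) ↔
      (∀ (M : Type u) [AddCommGroup M] [Module (upperTriangularTwo A) M]
        [Module.Finite (upperTriangularTwo A) M],
        IsTorsionless (upperTriangularTwo A) M →
          IsDoubleSemiGorensteinProjective (upperTriangularTwo A) M →
            IsGorensteinProjective (upperTriangularTwo A) M)) ∧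
    ((∀ (L : Type u) [AddCommGroup L] [Module A L] [Module.Finite A L],
        IsDoubleSemiGorensteinProjective A L → Function.Surjective (canonicalMap A L) →
          IsGorensteinProjective A L) ↔
      (∀ (M : Type u) [AddCommGroup M] [Module (upperTriangularTwo A) M]
        [Module.Finite (upperTriangularTwo A) M],
        IsDoubleSemiGorensteinProjective (upperTriangularTwo A) M →
          Function.Surjective (canonicalMap (upperTriangularTwo A) M) →
            IsGorensteinProjective (upperTriangularTwo A) M)) := by
  refine ⟨⟨fun H M _ _ _ ht hd => ?_, fun H L _ _ _ ht hd => ?_⟩,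
    ⟨fun H M _ _ _ hd hs => ?_, fun H L _ _ _ hd hs => ?_⟩⟩
  · obtain ⟨_, _⟩ := exists_restricted_structure A M
    have := Module.Finite.trans (R := A) (upperTriangularTwo A) M
    obtain ⟨hA, hD⟩ := isDoubleSemiGorensteinProjective_iff.1 hd
    exact ⟨hd, (isReflexiveModule_iff hD).2 (H M ht.restrictScalars hA).2⟩
  · obtain ⟨_, _, h⟩ := exists_upperTriangular_structure A L
    have := Module.Finite.of_restrictScalars_finite A (upperTriangularTwo A) L
    have hD := dualSurjective_of_smul_eq h
    exact ⟨hd, (isReflexiveModule_iff hD).1 (H L (isTorsionless_of_smul_eq h ht)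
      (isDoubleSemiGorensteinProjective_iff.2 ⟨hd, hD⟩)).2⟩
  · obtain ⟨_, _⟩ := exists_restricted_structure A M
    have := Module.Finite.trans (R := A) (upperTriangularTwo A) M
    obtain ⟨hA, hD⟩ := isDoubleSemiGorensteinProjective_iff.1 hd
    exact ⟨hd, (isReflexiveModule_iff hD).2 (H M hA ((canonicalMap_surjective_iff hD).1 hs)).2⟩
  · obtain ⟨_, _, h⟩ := exists_upperTriangular_structure A L
    have := Module.Finite.of_restrictScalars_finite A (upperTriangularTwo A) L
    have hD := dualSurjective_of_smul_eq h
    exact ⟨hd, (isReflexiveModule_iff hD).1 (H L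
      (isDoubleSemiGorensteinProjective_iff.2 ⟨hd, hD⟩)
      ((canonicalMap_surjective_iff hD).2 hs)).2⟩
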